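/- Conventions. An \emph{interior algebra} is a Boolean algebra $A$ with an operation $g$ such that $g(1)=1$, $g(ab)=g(a)g(b)$, $g(a)\le a$ and $g(g(a))=g(a)$. A variety is a class of algebras defined by equations, and $\mathbf{Eq}(K)$ is the variety generated by $K$. For a Heyting algebra $L$ let $\mathrm{Fr}(L)\supseteq L$ be its free Boolean extension (the Boolean subalgebra of the power set of the set of prime ideals of $L$ generated by the Stone embedding of $L$), let $$g_L\big((-u_1+v_1)\cdots(-u_n+v_n)\big)=(u_1\Rightarrow v_1)\cdots(u_n\Rightarrow v_n)\qquad(u_i,v_i\in L),$$ and let $\mathcal B(L)=\langle \mathrm{Fr}(L),g_L\rangle$, an interior algebra. For a Heyting homomorphism $h\colon L\to M$ let $\mathcal B(h)\colon\mathcal B(L)\to\mathcal B(M)$ be the unique homomorphism of interior algebras that extends $h$. For a variety $V$ of Heyting algebras put $\rho^*(V)=\mathbf{Eq}(\{\mathcal B(L):L\in V\})$. If $V$ is a variety and $A\in V$ is finitely presented in $V$, a \emph{unifier} of $A$ in $V$ is a pair $\langle u,M\rangle$ where $M\in V$ is finitely presented in $V$ and projective in $V$ (with respect to surjective homomorphisms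 between members of $V$), and $u\colon A\to M$ is a homomorphism; $A$ is \emph{unifiable} in $V$ if it has a unifier in $V$. A unifier $\langle u,M\rangle$ is \emph{more general} than $\langle v,N\rangle$, written $\langle u,M\rangle\succcurlyeq\langle v,N\rangle$, if $v=h\circ u$ for some homomorphism $h\colon M\to N$. An \emph{isomorphism} of unifiers $\langle u,M\rangle\to\langle v,N\rangle$ is an isomorphism $h\colon M\to N$ with $v=h\circ u$. Theorem. Let $V$ be a variety of Heyting algebras and let $L\in V$ be finitely presented and unifiable in $V$. Then $\mathcal B(L)$ is finitely presented in $\rho^*(V)$, and $\tau(\langle u,M\rangle)=\langle\mathcal B(u),\mathcal B(M)\rangle$ defines a map $\tau$ from the unifiers of $L$ in $V$ to the unifiers of $\mathcal B(L)$ in $\rho^*(V)$, such that: 1. $\tau$ is injective, where, as free Boolean extensions are determined only up to isomorphism, pairs are compared up to isomorphism: for unifiers $\langle u,M\rangle$, $\langle v,N\rangle$ of $L$ in $V$, each isomorphism of unifiers $\varphi\colon\tau(\langle u,M\rangle)\to\tau(\langle v,N\rangle)$ is $\mathcal B(\psi)$ for a unique isomorphism of unifiers $\psi\colon\langle u,M\rangle\to\langle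 v,N\rangle$; moreover, if $M=N$ and $\mathcal B(u)=\mathcal B(v)$, then $u=v$. 2. $\tau$ preserves $\succcurlyeq$: if $\langle u,M\rangle\succcurlyeq\langle v,N\rangle$, then $\tau(\langle u,M\rangle)\succcurlyeq\tau(\langle v,N\rangle)$. 3. If $\rho^*(V)$ is locally finite (finitely generated subalgebras of its members are finite), then $\tau$ is surjective up to isomorphism: each unifier of $\mathcal B(L)$ in $\rho^*(V)$ is isomorphic to $\tau(\langle u,M\rangle)$ for some unifier $\langle u,M\rangle$ of $L$ in $V$. -/

import Mathlib

open CategoryTheory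

universe u v w

namespace HeytingUnification

/-! ### Interior algebras -/

/-- An interior algebra: a Boolean algebra with an interior operator. -/
class InteriorAlgebra (A : Type u) extends BooleanAlgebra A where
  /-- The interior operator. -/
  int : A → A
  int_top : int ⊤ = ⊤
  int_inf : ∀ a b : A, int (a ⊓ b) = int a ⊓ int b
  int_le : ∀ a : A, int a ≤ a
  int_int : ∀ a : A, int (int a) = int a

/-- Homomorphisms of interior algebras. (Complements are preserved automatically by bounded
lattice homomorphisms between Boolean algebras.) -/
structure InteriorHom (A : Type u) (B : Type v) [InteriorAlgebra A] [InteriorAlgebra B] extends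
    BoundedLatticeHom A B where
  map_int' : ∀ a : A, toFun (InteriorAlgebra.int a) = InteriorAlgebra.int (toFun a)

namespace InteriorHom

variable {A : Type u} {B : Type v} {C : Type w} [InteriorAlgebra A] [InteriorAlgebra B]
  [InteriorAlgebra C]

instance : FunLike (InteriorHom A B) A B where
  coe f := f.toFun
  coe_injective f g h := by
    obtain ⟨f, _⟩ := f
    obtain ⟨g, _⟩ := g
    congr
    exact DFunLike.coe_injective h

instance : BoundedLatticeHomClass (InteriorHom A B) A B where
  map_sup f := f.map_sup'
  map_inf f := f.map_inf'
  map_top f := f.map_top'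
  map_bot f := f.map_bot'

theorem map_int (f : InteriorHom A B) (a : A) :
    f (InteriorAlgebra.int a) = InteriorAlgebra.int (f a) := f.map_int' a

/-- The identity homomorphism. -/
def id (A : Type u) [InteriorAlgebra A] : InteriorHom A A :=
  { BoundedLatticeHom.id A with map_int' := fun _ => rfl }

/-- Composition of homomorphisms. -/
def comp (g : InteriorHom B C) (f : InteriorHom A B) : InteriorHom A C :=
  { g.toBoundedLatticeHom.comp f.toBoundedLatticeHom with
    map_int' := fun a => (congrArg g (f.map_int a)).trans (g.map_int (f a)) }

end InteriorHom

/-- The category of interior algebras. -/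
structure IntAlg where
  /-- The underlying interior algebra. -/
  carrier : Type u
  [str : InteriorAlgebra carrier]

attribute [instance] IntAlg.str

namespace IntAlg

instance : CoeSort IntAlg.{u} (Type u) := ⟨IntAlg.carrier⟩

/-- Morphisms of interior algebras. -/
@[ext]
structure Hom (X Y : IntAlg.{u}) where
  /-- The underlying homomorphism. -/
  hom' : InteriorHom X Y

instance : Category IntAlg.{u} where
  Hom X Y := Hom X Y
  id X := ⟨InteriorHom.id X⟩
  comp f g := ⟨g.hom'.comp f.hom'⟩

instance : ConcreteCategory IntAlg.{u} (fun X Y => InteriorHom X Y) where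
  hom f := f.hom'
  ofHom f := ⟨f⟩

end IntAlg

/-! ### The free Boolean extension of a bounded distributive lattice -/

section FreeBooleanExtension

variable (L : Type u) [DistribLattice L] [BoundedOrder L]
variable {M : Type v} [DistribLattice M] [BoundedOrder M]
variable {N : Type w} [DistribLattice N] [BoundedOrder N]

/-- The set of prime ideals. -/
abbrev PrimeIdeals : Type u := {I : Order.Ideal L // I.IsPrime}

/-- The Stone embedding of a bounded distributive lattice into the power set of its set of prime
ideals. -/
def stone : BoundedLatticeHom L (Set (PrimeIdeals L)) where
  toFun a := {P | a ∉ P.1}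
  map_sup' a b := by
    ext P
    change (a ⊔ b ∉ P.1) ↔ (a ∉ P.1 ∨ b ∉ P.1)
    rw [Order.Ideal.sup_mem_iff]
    tauto
  map_inf' a b := by
    ext P
    change (a ⊓ b ∉ P.1) ↔ (a ∉ P.1 ∧ b ∉ P.1)
    constructor
    · exact fun h => ⟨fun ha => h (P.1.lower inf_le_left ha), fun hb => h (P.1.lower inf_le_right hb)⟩
    · exact fun h hab => (P.2.mem_or_mem hab).elim h.1 h.2
  map_top' := by
    ext P
    have := P.2.toIsProper.top_notMem
    simpa using this
  map_bot' := by
    ext P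
    simp

variable {L} in
theorem stone_le_stone {a b : L} : stone L a ≤ stone L b ↔ a ≤ b := by
  constructor
  · intro h
    by_contra hab
    obtain ⟨J, hJ, hIJ, hd⟩ := DistribLattice.prime_ideal_of_disjoint_filter_ideal
      (F := Order.PFilter.principal a) (I := Order.Ideal.principal b) (by
        rw [Set.disjoint_left]
        intro x hx hx'
        exact hab ((Order.PFilter.mem_principal.1 hx).trans (Order.Ideal.mem_principal.1 hx')))
    have h1 : (⟨J, hJ⟩ : PrimeIdeals L) ∈ stone L a := fun haJ =>
      Set.disjoint_left.1 hd (Order.PFilter.mem_principal.2 le_rfl) haJ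
    exact h h1 (hIJ (Order.Ideal.mem_principal.2 le_rfl))
  · exact fun h => OrderHomClass.mono (stone L) h

/-- The free Boolean extension `Fr(L)`, as a Boolean subalgebra of the power set of the set of prime
ideals: the one generated by the Stone embedding of `L`. -/
def Fr : BooleanSubalgebra (Set (PrimeIdeals L)) :=
  BooleanSubalgebra.closure (Set.range (stone L))

/-- The embedding of `L` in `Fr(L)`. -/
def ofLattice : BoundedLatticeHom L (Fr L) where
  toFun a := ⟨stone L a, BooleanSubalgebra.subset_closure ⟨a, rfl⟩⟩
  map_sup' a b := Subtype.ext (map_sup (stone L) a b)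
  map_inf' a b := Subtype.ext (map_inf (stone L) a b)
  map_top' := Subtype.ext (map_top (stone L))
  map_bot' := Subtype.ext (map_bot (stone L))

variable {L}

theorem ofLattice_le_ofLattice {a b : L} : ofLattice L a ≤ ofLattice L b ↔ a ≤ b :=
  stone_le_stone

/-- Every element of `Fr(L)` has the form `(-u₁ + v₁) ⋯ (-uₙ + vₙ)` with all `uᵢ, vᵢ` in `L`. -/
theorem exists_rep (a : Fr L) : ∃ t : Finset (L × L),
    a = t.inf fun p => (ofLattice L p.1)ᶜ ⊔ ofLattice L p.2 := by
  classical
  have hsub : IsSublattice (Set.range (stone L)) :=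
    ⟨by rintro _ ⟨x, rfl⟩ _ ⟨y, rfl⟩; exact ⟨x ⊔ y, map_sup _ _ _⟩,
     by rintro _ ⟨x, rfl⟩ _ ⟨y, rfl⟩; exact ⟨x ⊓ y, map_inf _ _ _⟩⟩
  obtain ⟨t, ht⟩ := (BooleanSubalgebra.mem_closure_iff_sup_sdiff hsub ⟨⊥, map_bot _⟩
    ⟨⊤, map_top _⟩).1 (BooleanSubalgebra.compl_mem a.2)
  refine ⟨t.image fun x => (x.1.2.choose, x.2.2.choose), ?_⟩
  have key : aᶜ = t.sup fun x => ofLattice L x.1.2.choose \ ofLattice L x.2.2.choose := by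
    apply Subtype.ext
    have h2 : ∀ s : Finset (Set.range (stone L) × Set.range (stone L)),
        ((s.sup fun x => ofLattice L x.1.2.choose \ ofLattice L x.2.2.choose : Fr L) :
          Set (PrimeIdeals L)) = s.sup fun x => x.1.1 \ x.2.1 := by
      intro s
      induction s using Finset.induction_on with
      | empty => rfl
      | insert x s _ ih =>
        rw [Finset.sup_insert, Finset.sup_insert, BooleanSubalgebra.val_sup, ih]
        congr 1
        change stone L x.1.2.choose \ stone L x.2.2.choose = _
        rw [x.1.2.choose_spec, x.2.2.choose_spec]
    rw [h2]
    exact ht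
  rw [← compl_compl a, key, Finset.compl_sup, Finset.inf_image]
  congr 1
  funext x
  change (_ \ _)ᶜ = _ᶜ ⊔ _
  rw [sdiff_eq, compl_inf, compl_compl]

/-- The inverse image of a prime ideal under a bounded lattice homomorphism. -/
def comapPrime (h : BoundedLatticeHom L M) (P : PrimeIdeals M) : PrimeIdeals L :=
  ⟨{ carrier := {a | h a ∈ P.1}
     lower' := fun _ _ hab ha => P.1.lower (OrderHomClass.mono h hab) ha
     nonempty' := ⟨⊥, by simp⟩
     directed' := fun a ha b hb => ⟨a ⊔ b, by
       change h (a ⊔ b) ∈ P.1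
       rw [map_sup]
       exact Order.Ideal.sup_mem ha hb, le_sup_left, le_sup_right⟩ }, by
    have : Order.Ideal.IsProper ({ carrier := {a | h a ∈ P.1}
                                   lower' := fun _ _ hab ha => P.1.lower (OrderHomClass.mono h hab) ha
                                   nonempty' := ⟨⊥, by simp⟩
                                   directed' := fun a ha b hb => ⟨a ⊔ b, by
                                     change h (a ⊔ b) ∈ P.1
                                     rw [map_sup]
                                     exact Order.Ideal.sup_mem ha hb, le_sup_left,
                                       le_sup_right⟩ } : Order.Ideal L) := by
      apply Order.Ideal.isProper_of_notMem (p := ⊤)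
      change h ⊤ ∉ P.1
      rw [map_top]
      exact P.2.toIsProper.top_notMem
    apply Order.Ideal.IsPrime.of_mem_or_mem
    intro x y hxy
    change h (x ⊓ y) ∈ P.1 at hxy
    rw [map_inf] at hxy
    exact P.2.mem_or_mem hxy⟩

/-- The Boolean homomorphism of power sets induced by a bounded lattice homomorphism. -/
def powMap (h : BoundedLatticeHom L M) :
    BoundedLatticeHom (Set (PrimeIdeals L)) (Set (PrimeIdeals M)) where
  toFun S := comapPrime h ⁻¹' S
  map_sup' _ _ := rfl
  map_inf' _ _ := rfl
  map_top' := rfl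
  map_bot' := rfl

theorem powMap_stone (h : BoundedLatticeHom L M) (a : L) :
    powMap h (stone L a) = stone M (h a) := rfl

theorem powMap_mem (h : BoundedLatticeHom L M) (a : Fr L) : powMap h a ∈ Fr M := by
  have : Fr L ≤ (Fr M).comap (powMap h) := by
    refine BooleanSubalgebra.closure_le.2 ?_
    rintro _ ⟨a, rfl⟩
    exact BooleanSubalgebra.subset_closure ⟨h a, rfl⟩
  exact this a.2

/-- The Boolean homomorphism `Fr(L) → Fr(M)` induced by a bounded lattice homomorphism. -/
def frMap (h : BoundedLatticeHom L M) : BoundedLatticeHom (Fr L) (Fr M) where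
  toFun a := ⟨powMap h a, powMap_mem h a⟩
  map_sup' _ _ := rfl
  map_inf' _ _ := rfl
  map_top' := rfl
  map_bot' := rfl

theorem frMap_ofLattice (h : BoundedLatticeHom L M) (a : L) :
    frMap h (ofLattice L a) = ofLattice M (h a) := rfl

end FreeBooleanExtension

/-! ### The functor `B` from Heyting algebras to interior algebras -/

section FunctorB

variable {L : Type u} [HeytingAlgebra L] {M : Type v} [HeytingAlgebra M]

/-- `(u₁ ⇨ v₁) ⋯ (uₙ ⇨ vₙ)` in `L`, where `a = (-u₁ + v₁) ⋯ (-uₙ + vₙ)` in `Fr(L)`. The value does not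
depend on the representation of `a`, see `interiorElt_eq`. -/
noncomputable def interiorElt (a : Fr L) : L :=
  (exists_rep a).choose.inf fun p => p.1 ⇨ p.2

theorem ofLattice_le_rep (t : Finset (L × L)) (m : L) :
    ofLattice L m ≤ (t.inf fun p => (ofLattice L p.1)ᶜ ⊔ ofLattice L p.2) ↔
      m ≤ t.inf fun p => p.1 ⇨ p.2 := by
  rw [Finset.le_inf_iff, Finset.le_inf_iff]
  refine forall₂_congr fun p _ => ?_
  rw [le_himp_iff, ← ofLattice_le_ofLattice (a := m ⊓ p.1), map_inf, sup_comm, ← himp_eq,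
    le_himp_iff]

theorem ofLattice_le_iff (m : L) (a : Fr L) : ofLattice L m ≤ a ↔ m ≤ interiorElt a := by
  conv_lhs => rw [(exists_rep a).choose_spec]
  exact ofLattice_le_rep _ _

theorem interiorElt_eq (t : Finset (L × L)) :
    interiorElt (t.inf fun p => (ofLattice L p.1)ᶜ ⊔ ofLattice L p.2) =
      t.inf fun p => p.1 ⇨ p.2 :=
  eq_of_forall_le_iff fun m => by rw [← ofLattice_le_iff, ofLattice_le_rep]

theorem interiorElt_ofLattice (a : L) : interiorElt (ofLattice L a) = a :=
  eq_of_forall_le_iff fun m => by rw [← ofLattice_le_iff, ofLattice_le_ofLattice]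

/-- The interior algebra `B(L) = ⟨Fr(L), g_L⟩`. -/
noncomputable instance : InteriorAlgebra (Fr L) where
  int a := ofLattice L (interiorElt a)
  int_top := by
    have h : interiorElt (⊤ : Fr L) = ⊤ := top_le_iff.1 ((ofLattice_le_iff _ _).1 le_top)
    rw [h, map_top]
  int_inf a b := by
    rw [← map_inf]
    congr 1
    exact eq_of_forall_le_iff fun m => by
      rw [← ofLattice_le_iff, le_inf_iff, le_inf_iff, ofLattice_le_iff, ofLattice_le_iff]
  int_le a := (ofLattice_le_iff _ _).2 le_rfl
  int_int a := by rw [interiorElt_ofLattice]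

theorem int_eq (a : Fr L) : InteriorAlgebra.int a = ofLattice L (interiorElt a) := rfl

/-- A Heyting homomorphism as a bounded lattice homomorphism. -/
def toBdd (h : HeytingHom L M) : BoundedLatticeHom L M where
  toFun := h
  map_sup' := map_sup h
  map_inf' := map_inf h
  map_top' := map_top h
  map_bot' := map_bot h

/-- The homomorphism of interior algebras `B(L) → B(M)` induced by a Heyting homomorphism. -/
noncomputable def extend (h : HeytingHom L M) : InteriorHom (Fr L) (Fr M) :=
  { frMap (toBdd h) with
    map_int' := fun a => by
      change frMap (toBdd h) (ofLattice L (interiorElt a)) =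
        ofLattice M (interiorElt (frMap (toBdd h) a))
      rw [frMap_ofLattice]
      congr 1
      classical
      obtain ⟨t, rfl⟩ := exists_rep a
      have h1 : frMap (toBdd h) (t.inf fun p => (ofLattice L p.1)ᶜ ⊔ ofLattice L p.2) =
          (t.image fun p => (h p.1, h p.2)).inf
            fun p => (ofLattice M p.1)ᶜ ⊔ ofLattice M p.2 := by
        rw [Finset.inf_image, map_finset_inf]
        congr 1
      have h2 : toBdd h (t.inf fun p => p.1 ⇨ p.2) =
          (t.image fun p => (h p.1, h p.2)).inf fun p => p.1 ⇨ p.2 := by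
        rw [Finset.inf_image, map_finset_inf]
        congr 1
        funext p
        exact map_himp h p.1 p.2
      rw [h1, interiorElt_eq, interiorElt_eq, h2] }

/-- `extend h` is the unique homomorphism of interior algebras that extends `h`. -/
theorem extend_unique (h : HeytingHom L M) (k : InteriorHom (Fr L) (Fr M)) :
    (∀ a, k (ofLattice L a) = ofLattice M (h a)) ↔ k = extend h := by
  constructor
  · intro hk
    apply DFunLike.ext
    intro a
    obtain ⟨t, rfl⟩ := exists_rep a
    have hk' : ∀ x : L, k (ofLattice L x) = extend h (ofLattice L x) := hk
    rw [map_finset_inf, map_finset_inf]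
    congr 1
    funext p
    simp only [Function.comp, map_sup, map_compl', hk']
  · rintro rfl a
    rfl

end FunctorB

/-- The functor `B` from Heyting algebras to interior algebras. -/
noncomputable def BFunctor : HeytAlg.{u} ⥤ IntAlg.{u} where
  obj L := ⟨Fr L⟩
  map h := ConcreteCategory.ofHom (C := IntAlg) (extend (ConcreteCategory.hom h))
  map_id _ := rfl
  map_comp _ _ := rfl

/-! ### Terms, varieties, finite presentability, projectivity -/

/-- Terms in the signature of Heyting algebras. -/
inductive HTerm (X : Type) : Type
  | var : X → HTerm X
  | bot : HTerm X
  | top : HTerm X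
  | sup : HTerm X → HTerm X → HTerm X
  | inf : HTerm X → HTerm X → HTerm X
  | imp : HTerm X → HTerm X → HTerm X

/-- The value of a term in a Heyting algebra. -/
def HTerm.eval {X : Type} {A : Type u} [HeytingAlgebra A] (x : X → A) : HTerm X → A
  | var i => x i
  | bot => ⊥
  | top => ⊤
  | sup s t => s.eval x ⊔ t.eval x
  | inf s t => s.eval x ⊓ t.eval x
  | imp s t => s.eval x ⇨ t.eval x

/-- Terms in the signature of interior algebras. -/
inductive ITerm (X : Type) : Type
  | var : X → ITerm X
  | bot : ITerm X
  | top : ITerm X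
  | sup : ITerm X → ITerm X → ITerm X
  | inf : ITerm X → ITerm X → ITerm X
  | compl : ITerm X → ITerm X
  | int : ITerm X → ITerm X

/-- The value of a term in an interior algebra. -/
def ITerm.eval {X : Type} {A : Type u} [InteriorAlgebra A] (x : X → A) : ITerm X → A
  | var i => x i
  | bot => ⊥
  | top => ⊤
  | sup s t => s.eval x ⊔ t.eval x
  | inf s t => s.eval x ⊓ t.eval x
  | compl s => (s.eval x)ᶜ
  | int s => InteriorAlgebra.int (s.eval x)

/-- A class of Heyting algebras is a variety if it is defined by a set of equations. -/
def IsHeytingVariety (V : ObjectProperty HeytAlg.{u}) : Prop :=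
  ∃ E : Set (HTerm ℕ × HTerm ℕ),
    ∀ A : HeytAlg.{u}, V A ↔ ∀ e ∈ E, ∀ x : ℕ → A, e.1.eval x = e.2.eval x

/-- The variety of interior algebras generated by a class `K`: all interior algebras that satisfy
every equation which holds throughout `K`. -/
def generatedVariety (K : ObjectProperty IntAlg.{u}) : ObjectProperty IntAlg.{u} := fun A =>
  ∀ s t : ITerm ℕ, (∀ B : IntAlg.{u}, K B → ∀ x : ℕ → B, s.eval x = t.eval x) →
    ∀ x : ℕ → A, s.eval x = t.eval x

/-- `ρ*(V)`, the variety generated by the interior algebras `B(L)` for `L` in `V`. -/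
def rhoStar (V : ObjectProperty HeytAlg.{u}) : ObjectProperty IntAlg.{u} :=
  generatedVariety fun A => ∃ L : HeytAlg.{u}, V L ∧ A = BFunctor.obj L

/-- A class of interior algebras is locally finite if each finitely generated subalgebra of a
member is finite. The subalgebra generated by `a₁, …, aₙ` consists of the values of the terms
in `n` variables. -/
def IsLocallyFinite (W : ObjectProperty IntAlg.{u}) : Prop :=
  ∀ A : IntAlg.{u}, W A → ∀ (n : ℕ) (a : Fin n → A),
    (Set.range fun t : ITerm (Fin n) => t.eval a).Finite

/-- The Heyting algebra `A` is finitely presented in the class `V`: it belongs to `V` and is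
presented in `V` by finitely many generators `a₁, …, aₙ` and finitely many relations. -/
def HeytingFinPresented (V : ObjectProperty HeytAlg.{u}) (A : HeytAlg.{u}) : Prop :=
  V A ∧ ∃ (n : ℕ) (R : Set (HTerm (Fin n) × HTerm (Fin n))) (a : Fin n → A), R.Finite ∧
    (∀ r ∈ R, r.1.eval a = r.2.eval a) ∧
    ∀ C : HeytAlg.{u}, V C → ∀ c : Fin n → C, (∀ r ∈ R, r.1.eval c = r.2.eval c) →
      ∃! h : A ⟶ C, ∀ i, h (a i) = c i

/-- The interior algebra `A` is finitely presented in the class `W`. -/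
def InteriorFinPresented (W : ObjectProperty IntAlg.{u}) (A : IntAlg.{u}) : Prop :=
  W A ∧ ∃ (n : ℕ) (R : Set (ITerm (Fin n) × ITerm (Fin n))) (a : Fin n → A), R.Finite ∧
    (∀ r ∈ R, r.1.eval a = r.2.eval a) ∧
    ∀ C : IntAlg.{u}, W C → ∀ c : Fin n → C, (∀ r ∈ R, r.1.eval c = r.2.eval c) →
      ∃! h : A ⟶ C, ∀ i, h (a i) = c i

section Projective

variable {𝒞 : Type v} [Category.{w} 𝒞] {FC : 𝒞 → 𝒞 → Type*} {CC : 𝒞 → Type*}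
  [∀ X Y, FunLike (FC X Y) (CC X) (CC Y)] [ConcreteCategory 𝒞 FC]

/-- `P` is projective in the class `V`: it belongs to `V`, and homomorphisms from `P` lift along
surjective homomorphisms between members of `V`. -/
def IsProjectiveIn (V : ObjectProperty 𝒞) (P : 𝒞) : Prop :=
  V P ∧ ∀ A B : 𝒞, V A → V B → ∀ f : A ⟶ B, Function.Surjective f → ∀ g : P ⟶ B,
    ∃ k : P ⟶ A, k ≫ f = g

end Projective

/-! ### Unifiers -/

/-- `⟨u, M⟩` is a unifier in `V` of the Heyting algebra `L`. -/
def IsHeytingUnifier (V : ObjectProperty HeytAlg.{u}) {L M : HeytAlg.{u}} (_u : L ⟶ M) : Prop :=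
  HeytingFinPresented V M ∧ IsProjectiveIn V M

/-- `⟨w, N⟩` is a unifier in `W` of the interior algebra `A`. -/
def IsInteriorUnifier (W : ObjectProperty IntAlg.{u}) {A N : IntAlg.{u}} (_w : A ⟶ N) : Prop :=
  InteriorFinPresented W N ∧ IsProjectiveIn W N

/-- `L` is unifiable relative to `V`: it is finitely presented in `V` and has a unifier. -/
def IsUnifiable (V : ObjectProperty HeytAlg.{u}) (L : HeytAlg.{u}) : Prop :=
  HeytingFinPresented V L ∧ ∃ (M : HeytAlg.{u}) (u : L ⟶ M), IsHeytingUnifier V u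

/-- `⟨u, M⟩` is more general than `⟨v, N⟩`. -/
def MoreGeneral {𝒞 : Type v} [Category.{w} 𝒞] {A M N : 𝒞} (u : A ⟶ M) (v : A ⟶ N) : Prop :=
  ∃ h : M ⟶ N, u ≫ h = v

end HeytingUnification

open HeytingUnification

/-!
Taking open elements is right adjoint to `B`, and the unit `L → Opens (B L)` is an isomorphism, so
`B` is fully faithful: this yields injectivity and the preservation of the quasiorder. The Gödel
translation shows that the open elements of an algebra in `ρ*(V)` form a member of `V`; hence
presentations and projectivity transfer along the adjunction.

The counit `B (Opens A) → A` is always injective. For surjectivity, all `B L` satisfy Grzegorczyk's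
law, hence so do all members of `ρ*(V)`, and in a finite algebra satisfying this law every atom is a
difference of two open elements, so that the counit is bijective. A finitely presented member of a
locally finite variety is finite, being generated by the generators of its presentation.
-/

namespace HeytingUnification

open InteriorAlgebra

section Opens

variable {A : Type u} {B : Type v} [InteriorAlgebra A] [InteriorAlgebra B]

theorem int_mono {a b : A} (h : a ≤ b) : int a ≤ int b := by
  rw [← inf_eq_left, ← int_inf, inf_eq_left.2 h]

theorem le_int_iff {a b : A} (ha : int a = a) : a ≤ int b ↔ a ≤ b :=
  ⟨fun h => h.trans (int_le b), fun h => ha.symm.le.trans (int_mono h)⟩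

variable (A) in
/-- The lattice of open elements of an interior algebra. -/
def Opens : Sublattice A where
  carrier := {a | int a = a}
  supClosed' _ ha _ hb := le_antisymm (int_le _) (sup_le
    (ha.symm.le.trans (int_mono le_sup_left)) (hb.symm.le.trans (int_mono le_sup_right)))
  infClosed' a ha b hb := (int_inf a b).trans (congrArg₂ _ ha hb)

namespace Opens

instance : BoundedOrder (Opens A) where
  top := ⟨⊤, int_top⟩
  bot := ⟨⊥, le_bot_iff.1 (int_le _)⟩
  le_top a := Subtype.coe_le_coe.1 (le_top : (a : A) ≤ ⊤)
  bot_le a := Subtype.coe_le_coe.1 (bot_le : ⊥ ≤ (a : A))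

instance : HeytingAlgebra (Opens A) :=
  HeytingAlgebra.ofHImp (fun a b => ⟨int ((a : A) ⇨ b), int_int _⟩) fun a b c => by
    rw [← Subtype.coe_le_coe, ← Subtype.coe_le_coe, le_int_iff a.2, le_himp_iff]
    rfl

variable (A) in
/-- The inclusion of the open elements, as a bounded lattice homomorphism. -/
def subtype : BoundedLatticeHom (Opens A) A where
  toFun := Subtype.val
  map_sup' _ _ := rfl
  map_inf' _ _ := rfl
  map_top' := rfl
  map_bot' := rfl

/-- The Heyting homomorphism between algebras of open elements which is induced by a homomorphism
of interior algebras. -/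
def map (f : InteriorHom A B) : HeytingHom (Opens A) (Opens B) where
  toFun a := ⟨f a, (f.map_int a).symm.trans (congrArg f a.2)⟩
  map_sup' a b := Subtype.ext (map_sup f (a : A) b)
  map_inf' a b := Subtype.ext (map_inf f (a : A) b)
  map_bot' := Subtype.ext (map_bot f)
  map_himp' a b := Subtype.ext ((f.map_int _).trans (congrArg int (map_himp f (a : A) b)))

theorem map_surjective {f : InteriorHom A B} (hf : Function.Surjective f) :
    Function.Surjective (map f) := by
  intro b
  obtain ⟨a, ha⟩ := hf b
  refine ⟨⟨int a, int_int a⟩, Subtype.ext ?_⟩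
  calc f (int a) = int (f a) := f.map_int a
    _ = b := by rw [ha, b.2]

end Opens

end Opens

section BooleanExtension

variable {L : Type v} [DistribLattice L] [BoundedOrder L] {A : Type u} [BooleanAlgebra A]

theorem exists_eq_inf_himp (a : Fr L) :
    ∃ t : Finset (L × L), a = t.inf fun p => ofLattice L p.1 ⇨ ofLattice L p.2 := by
  simpa only [himp_eq, sup_comm] using exists_rep a

theorem map_inf_himp {F : Type*} [FunLike F (Fr L) A] [BoundedLatticeHomClass F (Fr L) A] (f : F)
    (t : Finset (L × L)) :
    f (t.inf fun p => ofLattice L p.1 ⇨ ofLattice L p.2) =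
      t.inf fun p => f (ofLattice L p.1) ⇨ f (ofLattice L p.2) := by
  simp only [map_finset_inf, Function.comp_def, map_himp]

theorem fr_hom_ext {F : Type*} [FunLike F (Fr L) A] [BoundedLatticeHomClass F (Fr L) A] {f g : F}
    (h : ∀ a, f (ofLattice L a) = g (ofLattice L a)) : f = g := by
  refine DFunLike.ext f g fun a => ?_
  obtain ⟨t, rfl⟩ := exists_eq_inf_himp a
  simp only [map_inf_himp, h]

theorem ofLattice_surjective : Function.Surjective (ofLattice A) := by
  intro a
  obtain ⟨t, rfl⟩ := exists_eq_inf_himp a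
  exact ⟨t.inf fun p => p.1 ⇨ p.2, by simp only [map_finset_inf, Function.comp_def, map_himp]⟩

/-- A Boolean algebra is its own free Boolean extension. -/
noncomputable def ofLatticeEquiv (A : Type u) [BooleanAlgebra A] : A ≃o Fr A :=
  RelIso.ofSurjective (OrderEmbedding.ofMapLEIff (ofLattice A) fun _ _ => ofLattice_le_ofLattice)
    ofLattice_surjective

/-- The extension of a bounded lattice homomorphism from `L` to a Boolean algebra to `Fr(L)`. -/
noncomputable def frLift (k : BoundedLatticeHom L A) : BoundedLatticeHom (Fr L) A :=
  ((ofLatticeEquiv A).symm : BoundedLatticeHom (Fr A) A).comp (frMap k)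

theorem frLift_ofLattice (k : BoundedLatticeHom L A) (a : L) : frLift k (ofLattice L a) = k a :=
  (ofLatticeEquiv A).symm_apply_apply (k a)

theorem frLift_le_frLift {k : BoundedLatticeHom L A} (hk : Function.Injective k) {a b : Fr L} :
    frLift k a ≤ frLift k b ↔ a ≤ b := by
  have le_iff (u v : L) : k u ≤ k v ↔ u ≤ v := by
    rw [← inf_eq_left, ← map_inf, hk.eq_iff, inf_eq_left]
  have eq_top_iff (c : Fr L) : frLift k c = ⊤ ↔ c = ⊤ := by
    obtain ⟨t, rfl⟩ := exists_eq_inf_himp c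
    simp only [map_inf_himp, frLift_ofLattice, Finset.inf_eq_top_iff, himp_eq_top_iff, le_iff,
      ofLattice_le_ofLattice]
  rw [← himp_eq_top_iff, ← map_himp, eq_top_iff, himp_eq_top_iff]

theorem exists_le_and_inf_le {a : L} {p : Fr L} (hap : ¬ ofLattice L a ≤ p) :
    ∃ b c : L, b ≤ a ∧ ¬ ofLattice L b ≤ p ∧ ofLattice L c ≤ p ∧
      ofLattice L b ⊓ p ≤ ofLattice L c := by
  classical
  obtain ⟨t, ht⟩ := exists_eq_inf_himp p
  -- Meets of lattice elements occurring in `a` and `p`: there are finitely many of them, so one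
  -- that is minimal among those not below `p` exists.
  let D : Set L := infClosure (insert a (t.image Prod.fst ∪ t.image Prod.snd : Finset L))
  have hD : D.Finite := ((Finset.finite_toSet _).insert a).infClosure
  obtain ⟨b, hba, ⟨hbD, hbp⟩, hmin⟩ := (hD.sep fun d => ¬ ofLattice L d ≤ p).exists_le_minimal
    ⟨subset_infClosure (Set.mem_insert _ _), hap⟩
  have dichotomy {d : L} (hd : d ∈ D) : b ≤ d ∨ ofLattice L (b ⊓ d) ≤ p := by
    by_contra! h
    exact h.1 ((hmin ⟨infClosed_infClosure hbD hd, h.2⟩ inf_le_left).trans inf_le_right)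
  obtain ⟨⟨u, v⟩, huv, hb⟩ : ∃ q ∈ t, ¬ ofLattice L b ≤ ofLattice L q.1 ⇨ ofLattice L q.2 := by
    rw [ht, Finset.le_inf_iff] at hbp
    push Not at hbp
    exact hbp
  have hp : p ≤ ofLattice L u ⇨ ofLattice L v := ht.le.trans (Finset.inf_le huv)
  have hu : u ∈ D :=
    subset_infClosure (.inr (Finset.mem_union_left _ (Finset.mem_image_of_mem _ huv)))
  have hv : v ∈ D :=
    subset_infClosure (.inr (Finset.mem_union_right _ (Finset.mem_image_of_mem _ huv)))
  have hbu : b ≤ u := (dichotomy hu).resolve_right fun h => hb <| by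
    simpa only [map_inf, le_himp_iff, inf_assoc, inf_idem] using h.trans hp
  have hbv : ofLattice L (b ⊓ v) ≤ p := (dichotomy hv).resolve_left fun h =>
    hb ((ofLattice_le_ofLattice.2 h).trans le_himp)
  refine ⟨b, b ⊓ v, hba, hbp, hbv, ?_⟩
  calc ofLattice L b ⊓ p ≤ ofLattice L b ⊓ (ofLattice L u ⇨ ofLattice L v) := by gcongr
    _ ≤ ofLattice L b ⊓ (ofLattice L b ⇨ ofLattice L v) :=
      inf_le_inf_left _ (himp_le_himp_right (ofLattice_le_ofLattice.2 hbu))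
    _ = ofLattice L (b ⊓ v) := by rw [inf_himp, map_inf]

end BooleanExtension

section OpensFr

variable (L : Type v) [HeytingAlgebra L]

/-- The unit of the adjunction between `B` and `Opens`: each Heyting algebra `L` is the algebra of
open elements of `B(L)`. -/
noncomputable def opensFrEquiv : L ≃o Opens (Fr L) where
  toFun a := ⟨ofLattice L a, congrArg (ofLattice L) (interiorElt_ofLattice a)⟩
  invFun b := interiorElt (b : Fr L)
  left_inv := interiorElt_ofLattice
  right_inv b := Subtype.ext b.2
  map_rel_iff' := ofLattice_le_ofLattice

variable (A : Type u) [InteriorAlgebra A]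

/-- The counit of the adjunction between `B` and `Opens`. -/
noncomputable def opensLift : InteriorHom (Fr (Opens A)) A :=
  { frLift (Opens.subtype A) with
    map_int' := fun a => by
      have h : interiorElt a = (⟨int (frLift (Opens.subtype A) a), int_int _⟩ : Opens A) :=
        eq_of_forall_le_iff fun m => by
          rw [← ofLattice_le_iff, ← frLift_le_frLift (k := Opens.subtype A) Subtype.val_injective,
            frLift_ofLattice, ← Subtype.coe_le_coe, le_int_iff m.2]
          rfl
      exact (frLift_ofLattice _ _).trans (congrArg Subtype.val h) }

variable {A}

theorem opensLift_ofLattice (a : Opens A) : opensLift A (ofLattice (Opens A) a) = a :=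
  frLift_ofLattice _ a

theorem opensLift_injective : Function.Injective (opensLift A) := fun _ _ h =>
  le_antisymm ((frLift_le_frLift Subtype.val_injective).1 h.le)
    ((frLift_le_frLift Subtype.val_injective).1 h.ge)

end OpensFr

section Grzegorczyk

/-- Grzegorczyk's law for interior algebras, the algebraic form of the modal axiom
`□(□(p → □p) → p) → p`. -/
def IsGrzegorczyk (A : Type u) [InteriorAlgebra A] : Prop :=
  ∀ p : A, int (int (p ⇨ int p) ⇨ p) ≤ p

theorem isGrzegorczyk_fr (L : Type u) [HeytingAlgebra L] : IsGrzegorczyk (Fr L) := by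
  intro p
  by_contra hp
  obtain ⟨b, c, hb, hbp, hc, hbc⟩ := exists_le_and_inf_le hp
  have isOpen (a : L) : int (ofLattice L a) = ofLattice L a := (opensFrEquiv L a).2
  have hb_int : ofLattice L b ≤ int (p ⇨ int p) := by
    rw [le_int_iff (isOpen b), le_himp_iff]
    exact hbc.trans ((le_int_iff (isOpen c)).2 hc)
  have hb_himp : ofLattice L b ≤ int (p ⇨ int p) ⇨ p :=
    (ofLattice_le_ofLattice.2 hb).trans (int_le _)
  exact hbp ((le_inf hb_himp hb_int).trans himp_inf_le)

variable {A : Type u} [InteriorAlgebra A]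

theorem IsGrzegorczyk.eq_inf_compl_of_isAtom (hA : IsGrzegorczyk A) {x : A} (hx : IsAtom x) :
    x = int (xᶜ ⇨ int xᶜ) ⊓ (int xᶜ)ᶜ := by
  apply le_antisymm
  · refine le_inf ?_ (le_compl_comm.1 (int_le _))
    by_contra h
    have hle : int (xᶜ ⇨ int xᶜ) ≤ xᶜ := le_compl_iff_disjoint_left.2 (hx.not_le_iff_disjoint.1 h)
    have hcompl := hA xᶜ
    rw [himp_eq_top_iff.2 hle, int_top, top_le_iff, compl_eq_top] at hcompl
    exact hx.1 hcompl
  · calc int (xᶜ ⇨ int xᶜ) ⊓ (int xᶜ)ᶜ ≤ (xᶜ ⇨ int xᶜ) ⊓ (int xᶜ)ᶜ := by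
          gcongr
          exact int_le _
      _ = x ⊓ (int xᶜ)ᶜ := by
          rw [himp_eq, compl_compl, inf_sup_right, inf_compl_self, bot_sup_eq]
      _ ≤ x := inf_le_left

theorem mem_of_forall_isAtom_mem {A : Type u} [BooleanAlgebra A] [Finite A]
    {S : BooleanSubalgebra A} (hS : ∀ x : A, IsAtom x → x ∈ S) (a : A) : a ∈ S := by
  induction a using WellFoundedLT.induction with
  | ind a ih =>
    rcases eq_bot_or_exists_atom_le a with rfl | ⟨x, hx, hxa⟩
    · exact S.bot_mem
    · rw [← sup_sdiff_cancel_right hxa]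
      exact S.sup_mem (hS x hx) (ih _ (sdiff_lt hxa hx.1))

theorem IsGrzegorczyk.opensLift_bijective [Finite A] (hA : IsGrzegorczyk A) :
    Function.Bijective (opensLift A) := by
  refine ⟨opensLift_injective, fun a => ?_⟩
  let S : BooleanSubalgebra A := (⊤ : BooleanSubalgebra (Fr (Opens A))).map
    (opensLift A).toBoundedLatticeHom
  have int_mem (b : A) : int b ∈ S :=
    ⟨ofLattice _ ⟨int b, int_int b⟩, trivial, opensLift_ofLattice _⟩
  obtain ⟨c, -, hc⟩ : a ∈ S := mem_of_forall_isAtom_mem (fun x hx => by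
    rw [hA.eq_inf_compl_of_isAtom hx]
    exact S.inf_mem (int_mem _) (S.compl_mem (int_mem _))) a
  exact ⟨c, hc⟩

end Grzegorczyk

section Adjunction

theorem BFunctor_obj_hom_ext {L : HeytAlg.{u}} {A : IntAlg.{u}} {f g : BFunctor.obj L ⟶ A}
    (h : ∀ a : L, f (ofLattice L a) = g (ofLattice L a)) : f = g :=
  ConcreteCategory.hom_ext (C := IntAlg) f g (DFunLike.congr_fun
    (fr_hom_ext (L := L) (F := InteriorHom (Fr L) A) h))

/-- The functor from interior algebras to Heyting algebras given by the open elements. -/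
def opensFunctor : IntAlg.{u} ⥤ HeytAlg.{u} where
  obj A := HeytAlg.of (Opens A)
  map f := HeytAlg.ofHom (Opens.map (ConcreteCategory.hom f))

/-- The unit of `opensAdjunction`. -/
noncomputable def opensUnitIso : 𝟭 HeytAlg.{u} ≅ BFunctor ⋙ opensFunctor :=
  NatIso.ofComponents fun L => HeytAlg.Iso.mk (opensFrEquiv L)

/-- The functor `B` is left adjoint to taking open elements. -/
noncomputable def opensAdjunction : BFunctor.{u} ⊣ opensFunctor where
  unit := opensUnitIso.hom
  counit :=
    { app A := ConcreteCategory.ofHom (C := IntAlg) (opensLift A)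
      naturality A B f := BFunctor_obj_hom_ext fun a => by
        refine (opensLift_ofLattice _).trans ?_
        exact (congrArg (ConcreteCategory.hom f) (opensLift_ofLattice a)).symm }
  left_triangle_components L := BFunctor_obj_hom_ext fun a => opensLift_ofLattice _
  right_triangle_components A := by
    ext a
    exact Subtype.ext (opensLift_ofLattice a)

instance : IsIso opensAdjunction.{u}.unit := inferInstanceAs (IsIso opensUnitIso.hom)

instance : BFunctor.{u}.Full := opensAdjunction.fullyFaithfulLOfIsIsoUnit.full

instance : BFunctor.{u}.Faithful := opensAdjunction.fullyFaithfulLOfIsIsoUnit.faithful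

end Adjunction

section Functor

variable {𝒞 : Type*} [Category* 𝒞] {𝒟 : Type*} [Category* 𝒟]

theorem existsUnique_iso_of_map_comp_eq (F : 𝒞 ⥤ 𝒟) [F.Full] [F.Faithful] {X Y Z : 𝒞}
    {f : X ⟶ Y} {g : X ⟶ Z} {φ : F.obj Y ≅ F.obj Z} (h : F.map f ≫ φ.hom = F.map g) :
    ∃! ψ : Y ≅ Z, f ≫ ψ.hom = g ∧ F.map ψ.hom = φ.hom := by
  have map_preimageIso : F.map (F.preimageIso φ).hom = φ.hom := F.map_preimage φ.hom
  refine ⟨F.preimageIso φ, ⟨F.map_injective ?_, map_preimageIso⟩, fun ψ hψ => ?_⟩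
  · rw [F.map_comp, map_preimageIso, h]
  · exact Iso.ext (F.map_injective (hψ.2.trans map_preimageIso.symm))

theorem MoreGeneral.map (F : 𝒞 ⥤ 𝒟) {X Y Z : 𝒞} {f : X ⟶ Y} {g : X ⟶ Z} :
    MoreGeneral f g → MoreGeneral (F.map f) (F.map g) := by
  rintro ⟨h, rfl⟩
  exact ⟨F.map h, (F.map_comp f h).symm⟩

variable {FC : 𝒞 → 𝒞 → Type*} {CC : 𝒞 → Type*} [∀ X Y, FunLike (FC X Y) (CC X) (CC Y)]
  [ConcreteCategory 𝒞 FC] {FD : 𝒟 → 𝒟 → Type*} {CD : 𝒟 → Type*}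
  [∀ X Y, FunLike (FD X Y) (CD X) (CD Y)] [ConcreteCategory 𝒟 FD]
  {V : ObjectProperty 𝒞} {W : ObjectProperty 𝒟} {F : 𝒞 ⥤ 𝒟}

theorem IsProjectiveIn.leftAdjoint_obj {G : 𝒟 ⥤ 𝒞} (adj : F ⊣ G)
    (hF : ∀ X, V X → W (F.obj X)) (hG : ∀ Y, W Y → V (G.obj Y))
    (hG_surj : ∀ {Y Z : 𝒟} (f : Y ⟶ Z), Function.Surjective f → Function.Surjective (G.map f))
    {P : 𝒞} (hP : IsProjectiveIn V P) : IsProjectiveIn W (F.obj P) := by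
  refine ⟨hF P hP.1, fun Y Z hY hZ f hf g => ?_⟩
  obtain ⟨k, hk⟩ := hP.2 _ _ (hG Y hY) (hG Z hZ) (G.map f) (hG_surj f hf) (adj.homEquiv P Z g)
  refine ⟨(adj.homEquiv P Y).symm k, ?_⟩
  rw [← adj.homEquiv_naturality_right_symm, hk, Equiv.symm_apply_apply]

theorem IsProjectiveIn.of_obj_iso [F.Full] [F.Faithful] (hF : ∀ X, V X → W (F.obj X))
    (hF_surj : ∀ {X Y : 𝒞} (f : X ⟶ Y), Function.Surjective f → Function.Surjective (F.map f))
    {P : 𝒞} (hP : V P) {Q : 𝒟} (hQ : IsProjectiveIn W Q) (φ : F.obj P ≅ Q) :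
    IsProjectiveIn V P := by
  refine ⟨hP, fun X Y hX hY f hf g => ?_⟩
  obtain ⟨k, hk⟩ := hQ.2 _ _ (hF X hX) (hF Y hY) (F.map f) (hF_surj f hf) (φ.inv ≫ F.map g)
  refine ⟨F.preimage (φ.hom ≫ k), F.map_injective ?_⟩
  rw [F.map_comp, F.map_preimage, Category.assoc, hk, Iso.hom_inv_id_assoc]

end Functor

section Terms

variable {X : Type}

theorem HTerm.map_eval {L : Type u} {M : Type v} [HeytingAlgebra L] [HeytingAlgebra M]
    {F : Type*} [FunLike F L M] [HeytingHomClass F L M] (f : F) (x : X → L) (t : HTerm X) :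
    f (t.eval x) = t.eval fun i => f (x i) := by
  induction t with
  | var i => rfl
  | bot => exact map_bot f
  | top => exact map_top f
  | sup s t hs ht => simp only [eval, map_sup, hs, ht]
  | inf s t hs ht => simp only [eval, map_inf, hs, ht]
  | imp s t hs ht => simp only [eval, map_himp, hs, ht]

theorem InteriorHom.map_eval {A : Type u} {B : Type v} [InteriorAlgebra A] [InteriorAlgebra B]
    (f : InteriorHom A B) (x : X → A) (t : ITerm X) :
    f (t.eval x) = t.eval fun i => f (x i) := by
  induction t with
  | var i => rfl
  | bot => exact map_bot f
  | top => exact map_top f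
  | sup s t hs ht => simp only [ITerm.eval, map_sup, hs, ht]
  | inf s t hs ht => simp only [ITerm.eval, map_inf, hs, ht]
  | compl s hs => simp only [ITerm.eval, map_compl', hs]
  | int s hs => simp only [ITerm.eval, f.map_int, hs]

/-- The Boolean implication `s → t` as a term. -/
def ITerm.imp (s t : ITerm X) : ITerm X := .sup t (.compl s)

/-- The Gödel translation of Heyting terms into terms of interior algebras. -/
def HTerm.translate : HTerm X → ITerm X
  | var i => .int (.var i)
  | bot => .bot
  | top => .top
  | sup s t => .sup s.translate t.translate
  | inf s t => .inf s.translate t.translate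
  | imp s t => .int (.imp s.translate t.translate)

variable {A : Type u} [InteriorAlgebra A]

theorem ITerm.eval_imp (x : X → A) (s t : ITerm X) :
    (s.imp t).eval x = s.eval x ⇨ t.eval x :=
  himp_eq.symm

theorem HTerm.eval_translate {x : X → A} {y : X → Opens A} (h : ∀ i, int (x i) = y i)
    (t : HTerm X) : t.translate.eval x = t.eval y := by
  induction t with
  | var i => exact h i
  | bot => rfl
  | top => rfl
  | sup s t hs ht => exact congrArg₂ _ hs ht
  | inf s t hs ht => exact congrArg₂ _ hs ht
  | imp s t hs ht => rw [translate, ITerm.eval, ITerm.eval_imp, hs, ht]; rfl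

theorem HTerm.eval_translate_fr {L : Type u} [HeytingAlgebra L] (z : X → Fr L) (t : HTerm X) :
    t.translate.eval z = ofLattice L (t.eval fun i => interiorElt (z i)) :=
  (eval_translate (fun _ => rfl) t).trans
    (congrArg Subtype.val (map_eval (opensFrEquiv L) _ t).symm)

end Terms

section Varieties

theorem generatedVariety_of_injective {K : ObjectProperty IntAlg.{u}} {A B : IntAlg.{u}}
    (f : A ⟶ B) (hf : Function.Injective f) (hB : generatedVariety K B) :
    generatedVariety K A := fun s t h x => hf <| by
  rw [InteriorHom.map_eval, InteriorHom.map_eval, hB s t h]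

theorem isGrzegorczyk_of_generatedVariety {K : ObjectProperty IntAlg.{u}}
    (hK : ∀ B, K B → IsGrzegorczyk B) {A : IntAlg.{u}} (hA : generatedVariety K A) :
    IsGrzegorczyk A := by
  intro p
  let x : ITerm ℕ := .var 0
  let grz : ITerm ℕ := .int ((ITerm.int (x.imp x.int)).imp x)
  have eval_grz (B : IntAlg.{u}) (b : ℕ → B) :
      grz.eval b = int (int (b 0 ⇨ int (b 0)) ⇨ b 0) := by
    simp only [grz, x, ITerm.eval, ITerm.eval_imp]
  have h := hA (grz.inf x) grz (fun B hB b => by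
    rw [ITerm.eval, inf_eq_left, eval_grz]
    exact hK B hB (b 0)) fun _ => p
  rwa [ITerm.eval, inf_eq_left, eval_grz] at h

variable {V : ObjectProperty HeytAlg.{u}}

theorem rhoStar_BFunctor_obj (L : HeytAlg.{u}) (hL : V L) : rhoStar V (BFunctor.obj L) :=
  fun _ _ h x => h _ ⟨L, hL, rfl⟩ x

theorem isGrzegorczyk_of_rhoStar {A : IntAlg.{u}} (hA : rhoStar V A) : IsGrzegorczyk A := by
  refine isGrzegorczyk_of_generatedVariety ?_ hA
  rintro _ ⟨L, -, rfl⟩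
  exact isGrzegorczyk_fr L

theorem opensFunctor_obj_of_rhoStar (hV : IsHeytingVariety V) (A : IntAlg.{u})
    (hA : rhoStar V A) : V (opensFunctor.obj A) := by
  obtain ⟨E, hE⟩ := hV
  refine (hE (HeytAlg.of (Opens A))).2 fun e he (x : ℕ → Opens A) => Subtype.ext ?_
  have isOpen (i : ℕ) : int (x i : A) = x i := (x i).2
  rw [← HTerm.eval_translate isOpen, ← HTerm.eval_translate isOpen]
  refine hA _ _ ?_ _
  rintro _ ⟨L, hL, rfl⟩ (z : ℕ → Fr L)
  change e.1.translate.eval z = e.2.translate.eval z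
  rw [HTerm.eval_translate_fr, HTerm.eval_translate_fr, (hE L).1 hL e he]

end Varieties

section GeneratedSubalgebra

variable {X : Type} {A : Type u} [InteriorAlgebra A] (a : X → A)

/-- The subalgebra of an interior algebra which is generated by a family of elements. -/
def generated : BooleanSubalgebra A where
  carrier := Set.range fun t : ITerm X => t.eval a
  supClosed' := by rintro _ ⟨s, rfl⟩ _ ⟨t, rfl⟩; exact ⟨s.sup t, rfl⟩
  infClosed' := by rintro _ ⟨s, rfl⟩ _ ⟨t, rfl⟩; exact ⟨s.inf t, rfl⟩
  compl_mem' := by rintro _ ⟨s, rfl⟩; exact ⟨s.compl, rfl⟩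
  bot_mem' := ⟨.bot, rfl⟩

theorem int_mem_generated {b : A} : b ∈ generated a → int b ∈ generated a := by
  rintro ⟨t, rfl⟩
  exact ⟨t.int, rfl⟩

instance : InteriorAlgebra (generated a) where
  int b := ⟨int b, int_mem_generated a b.2⟩
  int_top := Subtype.ext int_top
  int_inf b c := Subtype.ext (int_inf (b : A) c)
  int_le b := int_le (b : A)
  int_int b := Subtype.ext (int_int (b : A))

/-- The inclusion of the subalgebra generated by a family of elements. -/
def generatedSubtype : InteriorHom (generated a) A where
  toFun := Subtype.val
  map_sup' _ _ := rfl
  map_inf' _ _ := rfl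
  map_top' := rfl
  map_bot' := rfl
  map_int' _ := rfl

end GeneratedSubalgebra

section FinPresented

theorem InteriorFinPresented.exists_eval_surjective {W : ObjectProperty IntAlg.{u}}
    (hW : ∀ {B C : IntAlg.{u}} (f : B ⟶ C), Function.Injective f → W C → W B)
    {A : IntAlg.{u}} (hA : InteriorFinPresented W A) :
    ∃ (n : ℕ) (a : Fin n → A), Function.Surjective fun t : ITerm (Fin n) => t.eval a := by
  obtain ⟨hA, n, R, a, -, hR, existsUnique_hom⟩ := hA
  let S : IntAlg.{u} := ⟨generated a⟩
  let ι : S ⟶ A := ConcreteCategory.ofHom (C := IntAlg) (generatedSubtype a)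
  have hι : Function.Injective ι := Subtype.val_injective
  let c : Fin n → S := fun i => ⟨a i, .var i, rfl⟩
  obtain ⟨r, hr, -⟩ := existsUnique_hom S (hW ι hι hA) c fun e he => hι <| by
    rw [InteriorHom.map_eval, InteriorHom.map_eval]
    exact hR e he
  have retraction : r ≫ ι = 𝟙 A :=
    (existsUnique_hom A hA a hR).unique (fun i => congrArg ι (hr i)) fun _ => rfl
  refine ⟨n, a, fun b => ?_⟩
  obtain ⟨t, ht⟩ := (r b).2
  exact ⟨t, ht.trans (ConcreteCategory.congr_hom retraction b)⟩

theorem InteriorFinPresented.finite {W : ObjectProperty IntAlg.{u}}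
    (hW : ∀ {B C : IntAlg.{u}} (f : B ⟶ C), Function.Injective f → W C → W B)
    (hfin : IsLocallyFinite W) {A : IntAlg.{u}} (hA : InteriorFinPresented W A) : Finite A := by
  obtain ⟨n, a, ha⟩ := hA.exists_eval_surjective hW
  rw [← Set.finite_univ_iff, ← ha.range_eq]
  exact hfin A hA.1 n a

variable {V : ObjectProperty HeytAlg.{u}}

theorem HeytingFinPresented.of_finite {A : HeytAlg.{u}} (hA : V A) [Finite A] :
    HeytingFinPresented V A := by
  obtain ⟨n, ⟨e⟩⟩ := Finite.exists_equiv_fin A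
  let x (a : A) : HTerm (Fin n) := .var (e a)
  -- The relations are the operation tables of `A`.
  let R : Set (HTerm (Fin n) × HTerm (Fin n)) :=
    {(.bot, x ⊥)} ∪ Set.range (fun p : A × A => (.sup (x p.1) (x p.2), x (p.1 ⊔ p.2))) ∪
      Set.range (fun p : A × A => (.inf (x p.1) (x p.2), x (p.1 ⊓ p.2))) ∪
      Set.range (fun p : A × A => (.imp (x p.1) (x p.2), x (p.1 ⇨ p.2)))
  have hR : R.Finite := (((Set.finite_singleton _).union (Set.finite_range _)).union
    (Set.finite_range _)).union (Set.finite_range _)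
  refine ⟨hA, n, R, e.symm, hR, ?_, fun C _ c hc => ?_⟩
  · rintro r (((rfl | ⟨p, rfl⟩) | ⟨p, rfl⟩) | ⟨p, rfl⟩) <;>
      simp only [x, HTerm.eval, Equiv.symm_apply_apply]
  · let h : HeytingHom A C :=
      { toFun a := c (e a)
        map_bot' := (hc (.bot, x ⊥) (.inl (.inl (.inl rfl)))).symm
        map_sup' a b := (hc (.sup (x a) (x b), x (a ⊔ b)) (.inl (.inl (.inr ⟨(a, b), rfl⟩)))).symm
        map_inf' a b := (hc (.inf (x a) (x b), x (a ⊓ b)) (.inl (.inr ⟨(a, b), rfl⟩))).symm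
        map_himp' a b := (hc (.imp (x a) (x b), x (a ⇨ b)) (.inr ⟨(a, b), rfl⟩)).symm }
    refine ⟨HeytAlg.ofHom h, fun i => congrArg c (e.apply_symm_apply i), fun k hk => ?_⟩
    ext a
    exact (congrArg k (e.symm_apply_apply a)).symm.trans (hk (e a))

theorem HeytingFinPresented.BFunctor_obj (hV : IsHeytingVariety V) {L : HeytAlg.{u}}
    (hL : HeytingFinPresented V L) : InteriorFinPresented (rhoStar V) (BFunctor.obj L) := by
  obtain ⟨hL, n, R, a, hfin, hR, existsUnique_hom⟩ := hL
  refine ⟨rhoStar_BFunctor_obj L hL, n, (fun r => (r.1.translate, r.2.translate)) '' R ∪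
    Set.range (fun i => (.int (.var i), .var i)), fun i => ofLattice L (a i),
    (hfin.image _).union (Set.finite_range _), ?_, fun C hC c hc => ?_⟩
  · have isOpen (i : Fin n) : int (ofLattice L (a i)) = opensFrEquiv L (a i) :=
      (opensFrEquiv L (a i)).2
    rintro _ (⟨r, hr, rfl⟩ | ⟨i, rfl⟩)
    · refine (HTerm.eval_translate isOpen _).trans (.trans ?_ (HTerm.eval_translate isOpen _).symm)
      rw [← HTerm.map_eval, ← HTerm.map_eval, hR r hr]
    · exact isOpen i
  · let y (i : Fin n) : Opens C := ⟨c i, hc _ (.inr ⟨i, rfl⟩)⟩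
    have isOpen (i : Fin n) : int (c i) = y i := (y i).2
    have hy : ∀ r ∈ R, r.1.eval y = r.2.eval y := fun r hr => Subtype.ext <| by
      rw [← HTerm.eval_translate isOpen, ← HTerm.eval_translate isOpen]
      exact hc _ (.inl ⟨r, hr, rfl⟩)
    have transpose (h : BFunctor.obj L ⟶ C) : (∀ i, h (ofLattice L (a i)) = c i) ↔
        ∀ i, opensAdjunction.homEquiv L C h (a i) = y i :=
      forall_congr' fun i =>
        (Subtype.ext_iff (a1 := opensAdjunction.homEquiv L C h (a i)) (a2 := y i)).symm
    exact ((opensAdjunction.homEquiv L C).existsUnique_congr transpose).2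
      (existsUnique_hom _ (opensFunctor_obj_of_rhoStar hV C hC) y hy)

end FinPresented

section Unifiers

theorem extend_surjective {L : Type u} {M : Type v} [HeytingAlgebra L] [HeytingAlgebra M]
    {h : HeytingHom L M} (hh : Function.Surjective h) : Function.Surjective (extend h) := by
  classical
  intro b
  obtain ⟨t, rfl⟩ := exists_eq_inf_himp b
  choose s hs using hh
  refine ⟨(t.image (Prod.map s s)).inf fun p => ofLattice L p.1 ⇨ ofLattice L p.2, ?_⟩
  have extend_ofLattice (m : M) : extend h (ofLattice L (s m)) = ofLattice M m :=
    congrArg (ofLattice M) (hs m)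
  simp only [Finset.inf_image, map_finset_inf, Function.comp_def, map_himp, Prod.map_fst,
    Prod.map_snd, extend_ofLattice]

theorem IntAlg.isIso_of_bijective {A B : IntAlg.{u}} (f : A ⟶ B) (hf : Function.Bijective f) :
    IsIso f := by
  let e := Equiv.ofBijective f hf
  have apply_symm (b : B) : f (e.symm b) = b := e.apply_symm_apply b
  let g : InteriorHom B A :=
    { toFun := e.symm
      map_sup' a b := hf.1 ((apply_symm _).trans (by rw [map_sup, apply_symm, apply_symm]))
      map_inf' a b := hf.1 ((apply_symm _).trans (by rw [map_inf, apply_symm, apply_symm]))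
      map_top' := hf.1 ((apply_symm _).trans (map_top (ConcreteCategory.hom f)).symm)
      map_bot' := hf.1 ((apply_symm _).trans (map_bot (ConcreteCategory.hom f)).symm)
      map_int' a := hf.1 <| (apply_symm _).trans
        ((congrArg int (apply_symm a)).symm.trans (InteriorHom.map_int _ _).symm) }
  exact ⟨ConcreteCategory.ofHom (C := IntAlg) g,
    ConcreteCategory.hom_ext (C := IntAlg) _ _ e.symm_apply_apply,
    ConcreteCategory.hom_ext (C := IntAlg) _ _ e.apply_symm_apply⟩

variable {V : ObjectProperty HeytAlg.{u}}

theorem IsHeytingUnifier.BFunctor_map (hV : IsHeytingVariety V) {L M : HeytAlg.{u}} {f : L ⟶ M}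
    (hf : IsHeytingUnifier V f) : IsInteriorUnifier (rhoStar V) (BFunctor.map f) :=
  ⟨hf.1.BFunctor_obj hV, hf.2.leftAdjoint_obj opensAdjunction rhoStar_BFunctor_obj
    (opensFunctor_obj_of_rhoStar hV) fun _ => Opens.map_surjective⟩

theorem exists_isHeytingUnifier_of_isLocallyFinite (hV : IsHeytingVariety V)
    (hfin : IsLocallyFinite (rhoStar V)) {L : HeytAlg.{u}} {N : IntAlg.{u}}
    {g : BFunctor.obj L ⟶ N} (hg : IsInteriorUnifier (rhoStar V) g) :
    ∃ (M : HeytAlg.{u}) (f : L ⟶ M), IsHeytingUnifier V f ∧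
      ∃ φ : BFunctor.obj M ≅ N, BFunctor.map f ≫ φ.hom = g := by
  obtain ⟨hN, hN_proj⟩ := hg
  have : Finite N := hN.finite generatedVariety_of_injective hfin
  have : Finite (opensFunctor.obj N) := inferInstanceAs (Finite (Opens N))
  have : IsIso (opensAdjunction.counit.app N) :=
    IntAlg.isIso_of_bijective _ (isGrzegorczyk_of_rhoStar hN.1).opensLift_bijective
  have hM : V (opensFunctor.obj N) := opensFunctor_obj_of_rhoStar hV N hN.1
  let φ : BFunctor.obj (opensFunctor.obj N) ≅ N := asIso (opensAdjunction.counit.app N)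
  refine ⟨opensFunctor.obj N, opensAdjunction.homEquiv L N g, ⟨.of_finite hM, ?_⟩, φ, ?_⟩
  · exact .of_obj_iso rhoStar_BFunctor_obj (fun _ => extend_surjective) hM hN_proj φ
  · exact (opensAdjunction.homEquiv_counit ..).symm.trans (Equiv.symm_apply_apply _ g)

end Unifiers

end HeytingUnification

theorem mainTheorem5 (V : ObjectProperty HeytAlg.{u})
    (hV : IsHeytingVariety V) (L : HeytAlg.{u})
    (hL : IsUnifiable V L) :
    -- `τ` is well defined: `B(L)` is finitely presented, and images of unifiers are unifiers
    InteriorFinPresented (rhoStar V)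
      (BFunctor.obj L) ∧
    (∀ (M : HeytAlg.{u}) (f : L ⟶ M), IsHeytingUnifier V f →
      IsInteriorUnifier (rhoStar V)
        (BFunctor.map f)) ∧
    -- `τ` is injective: each isomorphism of the images of two unifiers comes from a unique
    -- isomorphism of the unifiers; and unifiers with the same target and the same image are equal
    (∀ (M₀ M₁ : HeytAlg.{u}) (f₀ : L ⟶ M₀) (f₁ : L ⟶ M₁),
      IsHeytingUnifier V f₀ → IsHeytingUnifier V f₁ →
      ∀ φ : BFunctor.obj M₀ ≅ BFunctor.obj M₁,
        BFunctor.map f₀ ≫ φ.hom = BFunctor.map f₁ →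
        ∃! ψ : M₀ ≅ M₁, f₀ ≫ ψ.hom = f₁ ∧ BFunctor.map ψ.hom = φ.hom) ∧
    (∀ (M : HeytAlg.{u}) (f₀ f₁ : L ⟶ M), IsHeytingUnifier V f₀ → IsHeytingUnifier V f₁ →
      BFunctor.map f₀ = BFunctor.map f₁ → f₀ = f₁) ∧
    -- `τ` preserves the quasiorder
    (∀ (M₀ M₁ : HeytAlg.{u}) (f₀ : L ⟶ M₀) (f₁ : L ⟶ M₁),
      IsHeytingUnifier V f₀ → IsHeytingUnifier V f₁ →
      MoreGeneral f₀ f₁ →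
      MoreGeneral (BFunctor.map f₀)
        (BFunctor.map f₁)) ∧
    -- if `ρ*(V)` is locally finite, then `τ` is surjective
    (IsLocallyFinite (rhoStar V) →
      ∀ (N : IntAlg.{u}) (g : BFunctor.obj L ⟶ N),
        IsInteriorUnifier (rhoStar V) g →
        ∃ (M : HeytAlg.{u}) (f : L ⟶ M), IsHeytingUnifier V f ∧
          ∃ φ : BFunctor.obj M ≅ N,
            BFunctor.map f ≫ φ.hom = g) := by
  refine ⟨hL.1.BFunctor_obj hV, fun M f hf => hf.BFunctor_map hV, ?_, ?_, ?_, ?_⟩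
  · intro M₀ M₁ f₀ f₁ _ _ φ hφ
    exact existsUnique_iso_of_map_comp_eq BFunctor hφ
  · intro M f₀ f₁ _ _ h
    exact BFunctor.map_injective h
  · intro M₀ M₁ f₀ f₁ _ _ h
    exact h.map BFunctor
  · intro hfin N g hg
    exact exists_isHeytingUnifier_of_isLocallyFinite hV hfin hg
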